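/- Let $E$ be a real Banach lattice with order continuous norm, i.e. every nonempty downwards directed subset of $E$ that is bounded below converges in norm (as a downwards indexed net). For $v\in E$ let $|v|^d=\{w\in E:\ |v|\wedge|w|=0\}$, and for $v\in E_+$ let $E_v$ be the band generated by $v$, that is (the norm being order continuous) the norm closure of the ideal $\{w\in E:\ \exists n\in\mathbb N,\ |w|\le nv\}$. Then for every $v\in E$ $$E=E_{v^+}\oplus E_{v^-}\oplus|v|^d .$$ Denote by $P_{v^+},P_{v^-},P_{|v|^d}$ the projections along this decomposition and put $(\operatorname{sign}v)(w):=P_{v^+}w-P_{v^-}w$. Let $\Omega\subset\mathbb R^d$ be open, $1\le p\le\infty$. Here $W^{1,p}(\Omega,E)$ is the space of all $u\in L^p(\Omega,E)$ for which there are $D_ju\in L^p(\Omega,E)$ $(j=1,\dots,d)$ with $\int_\Omega u\,\partial_j\varphi=-\int_\Omega D_ju\,\varphi$ for all $\varphi\in C_c^\infty(\Omega,\mathbb R)$. Let $u\in W^{1,p}(\Omega,E)$. Then, with lattice operations and projections applied pointwise and the equalities below holding almost everywhere on $\Omega$, for all $j=1,\dots,d$: 1. $|u|\in W^{1,p}(\Omega,E)$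 and $D_j|u|=(\operatorname{sign}u)\,D_ju$; 2. $u^+\in W^{1,p}(\Omega,E)$ and $D_ju^+=P_{u^+}D_ju$; 3. if $w\in E_+$ and $|u|\wedge w=0$ almost everywhere, then $|D_ju|\wedge w=0$ almost everywhere. -/

import Mathlib

open MeasureTheory Filter Topology
open scoped ENNReal ContDiff

section Lattice

variable {E : Type*} [NormedAddCommGroup E] [NormedSpace ℝ E] [Lattice E]
  [IsOrderedAddMonoid E] [IsOrderedModule ℝ E]

/-- The norm of `E` is order continuous: every nonempty, downwards directed set that is bounded
below converges in norm, as a net indexed by itself and running downwards. -/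
def HasOrderContinuousNorm (E : Type*) [NormedAddCommGroup E] [Lattice E] : Prop :=
  ∀ A : Set E, A.Nonempty → DirectedOn (· ≥ ·) A → BddBelow A →
    ∃ x₀ : E, Tendsto (fun x : A => (x : E)) atBot (𝓝 x₀)

set_option linter.unusedSectionVars false

theorem abs_real_smul_le (c : ℝ) (a : E) : |c • a| ≤ |c| • |a| := by
  have key : ∀ b : E, c • b ≤ |c| • |b| := by
    intro b
    rcases le_total 0 c with hc | hc
    · rw [abs_of_nonneg hc]
      exact smul_le_smul_of_nonneg_left (le_abs_self b) hc
    · rw [abs_of_nonpos hc, ← neg_smul_neg]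
      exact smul_le_smul_of_nonneg_left (neg_le_abs b) (by linarith)
  refine abs_le'.2 ⟨key a, ?_⟩
  simpa using key (-a)

theorem abs_real_smul_le_nsmul (c : ℝ) (a : E) : ∃ k : ℕ, |c • a| ≤ k • |a| := by
  obtain ⟨k, hk⟩ := exists_nat_ge |c|
  refine ⟨k, (abs_real_smul_le c a).trans ?_⟩
  rw [← Nat.cast_smul_eq_nsmul ℝ]
  exact smul_le_smul_of_nonneg_right hk (abs_nonneg a)

/-- The order ideal `{w | ∃ n, |w| ≤ n v}` generated by a positive element `v`. -/
def principalIdeal (v : E) : Submodule ℝ E where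
  carrier := {w | ∃ n : ℕ, |w| ≤ n • v}
  zero_mem' := ⟨0, by simp⟩
  add_mem' := by
    rintro a b ⟨n, hn⟩ ⟨m, hm⟩
    exact ⟨n + m, (abs_add_le a b).trans (by rw [add_nsmul]; exact add_le_add hn hm)⟩
  smul_mem' := by
    rintro c a ⟨n, hn⟩
    obtain ⟨k, hk⟩ := abs_real_smul_le_nsmul c a
    exact ⟨n * k, hk.trans (by rw [mul_nsmul]; exact nsmul_le_nsmul_right hn k)⟩

theorem inf_add_eq_zero_of_nonneg {x a b : E} (hx : 0 ≤ x) (ha : 0 ≤ a) (hb : 0 ≤ b)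
    (hxa : x ⊓ a = 0) (hxb : x ⊓ b = 0) : x ⊓ (a + b) = 0 := by
  refine le_antisymm ?_ (le_inf hx (add_nonneg ha hb))
  have h1 : x ⊓ (a + b) - b ≤ x ⊓ a :=
    le_inf ((sub_le_self _ hb).trans inf_le_left) (sub_le_iff_le_add.2 inf_le_right)
  rw [hxa, sub_nonpos] at h1
  exact (le_inf inf_le_left h1).trans hxb.le

theorem inf_nsmul_eq_zero_of_nonneg {x a : E} (hx : 0 ≤ x) (ha : 0 ≤ a) (h : x ⊓ a = 0) (n : ℕ) :
    x ⊓ (n • a) = 0 := by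
  induction n with
  | zero => simpa using hx
  | succ k ih =>
    rw [succ_nsmul]
    exact inf_add_eq_zero_of_nonneg hx (nsmul_nonneg ha k) ha ih h

/-- The disjoint complement `{w | |v| ∧ |w| = 0}` of `v`. -/
def disjointCompl (v : E) : Submodule ℝ E where
  carrier := {w | |v| ⊓ |w| = 0}
  zero_mem' := by simp
  add_mem' := by
    intro a b ha hb
    refine le_antisymm ((inf_le_inf_left _ (abs_add_le a b)).trans ?_)
      (le_inf (abs_nonneg _) (abs_nonneg _))
    exact (inf_add_eq_zero_of_nonneg (abs_nonneg _) (abs_nonneg _) (abs_nonneg _) ha hb).le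
  smul_mem' := by
    intro c a ha
    obtain ⟨k, hk⟩ := abs_real_smul_le_nsmul c a
    refine le_antisymm ((inf_le_inf_left _ hk).trans ?_) (le_inf (abs_nonneg _) (abs_nonneg _))
    exact (inf_nsmul_eq_zero_of_nonneg (abs_nonneg _) (abs_nonneg _) ha k).le

/-- The norm closure of the ideal generated by a positive element `v`. If the norm is order
continuous, closed ideals are bands, and this is the band generated by `v`. -/
def principalBand (v : E) : Submodule ℝ E :=
  (principalIdeal v).topologicalClosure

/-- The three summands `E_{v⁺}`, `E_{v⁻}`, `|v|ᵈ`. -/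
def signSummands (v : E) : Fin 3 → Submodule ℝ E :=
  ![principalBand v⁺, principalBand v⁻, disjointCompl v]

open Classical in
/-- The projection `P_{v⁺}` onto `E_{v⁺}` along `E_{v⁻} ⊕ |v|ᵈ` (with the value `0` if these are
not complementary, which does not happen if the norm is order continuous). -/
noncomputable def projPos (v : E) : E →ₗ[ℝ] E :=
  if h : IsCompl (principalBand v⁺) (principalBand v⁻ ⊔ disjointCompl v) then Submodule.projection _ _ h else 0

open Classical in
/-- The projection `P_{v⁻}` onto `E_{v⁻}` along `E_{v⁺} ⊕ |v|ᵈ` (with the value `0` if these are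
not complementary, which does not happen if the norm is order continuous). -/
noncomputable def projNeg (v : E) : E →ₗ[ℝ] E :=
  if h : IsCompl (principalBand v⁻) (principalBand v⁺ ⊔ disjointCompl v) then Submodule.projection _ _ h else 0

/-- `(sign v) w = P_{v⁺} w - P_{v⁻} w`. -/
noncomputable def latticeSign (v : E) : E →ₗ[ℝ] E :=
  projPos v - projNeg v

end Lattice

section Sobolev

variable {d : ℕ} {X : Type*} [NormedAddCommGroup X] [NormedSpace ℝ X]

/-- `v` is the distributional derivative `D_j u ∈ Lᵖ(Ω, X)` of `u`:
`∫_Ω u ∂_j φ = - ∫_Ω v φ` for all real test functions `φ ∈ C_c^∞(Ω)`. -/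
def IsDistribDeriv (Ω : Set (EuclideanSpace ℝ (Fin d))) (p : ℝ≥0∞) (j : Fin d)
    (u v : EuclideanSpace ℝ (Fin d) → X) : Prop :=
  MemLp v p (volume.restrict Ω) ∧
    ∀ φ : EuclideanSpace ℝ (Fin d) → ℝ, ContDiff ℝ ∞ φ → HasCompactSupport φ → tsupport φ ⊆ Ω →
      ∫ ξ in Ω, (fderiv ℝ φ ξ (EuclideanSpace.single j 1)) • u ξ = - ∫ ξ in Ω, φ ξ • v ξ

/-- `u ∈ W^{1,p}(Ω, X)`. -/
def MemSobolev (Ω : Set (EuclideanSpace ℝ (Fin d))) (p : ℝ≥0∞)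
    (u : EuclideanSpace ℝ (Fin d) → X) : Prop :=
  MemLp u p (volume.restrict Ω) ∧ ∀ j : Fin d, ∃ v, IsDistribDeriv Ω p j u v

end Sobolev

/-! ### Moduli of disjoint sums. -/

section LatticeGroup

variable {E : Type*} [AddCommGroup E] [Lattice E] [IsOrderedAddMonoid E]

/-! The modulus has one-sided directional derivatives everywhere. Split a direction `w` as `x + y +
z` along the bands of `v⁺`, `v⁻` and the disjoint complement of `v`. Moduli add on disjoint
elements, so `|v + t w| = |v⁺ + t x| + |v⁻ - t y| + |t| |z|`. The first two terms are differentiable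
at `t = 0`, with derivatives `x` and `-y`; the last has slopes `|z|` and `-|z|` from the right and
the left (`tendsto_abs_quotient_aux`). Order continuity of the norm is what provides the splitting
(`exists_add_of_nonneg`).

These slopes enter a chain rule (`integral_fderiv_smul_comp_of_lipschitz`). After a cutoff, `u` is
integrable and differentiable in `L¹` along translations, and the modulus is nonexpansive; so the
difference quotients of `|u|` may be replaced by those of `t ↦ |u + t D_j u|`, which converge
pointwise and are dominated by `‖D_j u‖`.

Hence both one-sided derivatives are weak derivatives of `|u|`. Uniqueness forces them to agree
almost everywhere, so the component of `D_j u` disjoint from `u` vanishes. The formula for `|u|`,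
the one for `u⁺ = (|u| + u) / 2`, and the statement on disjointness all follow from this. -/

theorem abs_add_of_abs_inf_abs_eq_zero {a b : E} (h : |a| ⊓ |b| = 0) : |a + b| = |a| + |b| := by
  have key : ∀ {a b : E}, |a| ⊓ |b| = 0 → |a| ≤ |a + b| := by
    intro a b h
    have h1 : |a| ≤ |a + b| + |b| := by
      have := abs_add_le (a + b) (-b)
      rwa [add_neg_cancel_right, abs_neg] at this
    -- The difference lies below both `|a|` and `|b|`, hence below their infimum `0`.
    have h2 : |a| - |a + b| ≤ |a| ⊓ |b| :=
      le_inf (sub_le_self _ (abs_nonneg _)) (sub_le_iff_le_add'.2 h1)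
    rwa [h, sub_nonpos] at h2
  refine le_antisymm (abs_add_le a b) ?_
  have h3 : |b| ≤ |a + b| := by
    rw [add_comm]
    exact key (by rwa [inf_comm])
  calc |a| + |b| = |a| ⊓ |b| + |a| ⊔ |b| := (inf_add_sup _ _).symm
    _ = |a| ⊔ |b| := by rw [h, zero_add]
    _ ≤ |a + b| := sup_le (key h) h3

end LatticeGroup

/-! ### Disjointness, bands and the sign decomposition. -/

section BanachLattice

set_option linter.unusedSectionVars false

variable {E : Type*} [NormedAddCommGroup E] [NormedSpace ℝ E]
  [Lattice E] [IsOrderedAddMonoid E] [IsOrderedModule ℝ E]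

theorem mem_disjointCompl {v w : E} : w ∈ disjointCompl v ↔ |v| ⊓ |w| = 0 := Iff.rfl

theorem mem_disjointCompl_comm {v w : E} : w ∈ disjointCompl v ↔ v ∈ disjointCompl w := by
  rw [mem_disjointCompl, mem_disjointCompl, inf_comm]

theorem abs_smul_of_real (c : ℝ) (x : E) : |c • x| = |c| • |x| := by
  refine le_antisymm (abs_real_smul_le c x) ?_
  rcases eq_or_ne c 0 with rfl | hc
  · simp
  · have h := abs_real_smul_le c⁻¹ (c • x)
    rw [inv_smul_smul₀ hc] at h
    calc |c| • |x| ≤ |c| • (|c⁻¹| • |c • x|) := smul_le_smul_of_nonneg_left h (abs_nonneg c)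
      _ = |c • x| := by rw [abs_inv, smul_inv_smul₀ (abs_ne_zero.2 hc)]

variable [HasSolidNorm E]

theorem continuous_lattice_abs : Continuous fun x : E => |x| := continuous_id.sup continuous_neg

theorem isClosed_disjointCompl (v : E) : IsClosed (disjointCompl v : Set E) :=
  isClosed_eq (continuous_const.inf continuous_lattice_abs) continuous_const

theorem eq_zero_of_mem_disjointCompl_self {x : E} (h : x ∈ disjointCompl x) : x = 0 := by
  rw [mem_disjointCompl, inf_idem] at h
  rw [← norm_eq_zero, ← norm_abs_eq_norm, h, norm_zero]

/-- Disjointness passes from `a` to its multiples, to everything they dominate, and to norm limits,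
since lattice operations are continuous. Applied once on each side, this makes the three summands
pairwise disjoint. -/
theorem principalBand_le_disjointCompl {a b : E} (ha : 0 ≤ a) (h : a ∈ disjointCompl b) :
    principalBand a ≤ disjointCompl b := by
  refine Submodule.topologicalClosure_minimal _ ?_ (isClosed_disjointCompl b)
  rintro w ⟨n, hn⟩
  rw [mem_disjointCompl, abs_of_nonneg ha] at h
  refine mem_disjointCompl.2 (le_antisymm ((inf_le_inf_left _ hn).trans ?_)
    (le_inf (abs_nonneg _) (abs_nonneg _)))
  exact (inf_nsmul_eq_zero_of_nonneg (abs_nonneg _) ha h n).le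

theorem posPart_mem_disjointCompl_negPart (v : E) : v⁺ ∈ disjointCompl v⁻ := by
  rw [mem_disjointCompl, abs_of_nonneg (negPart_nonneg v), abs_of_nonneg (posPart_nonneg v),
    inf_comm, posPart_inf_negPart_eq_zero]

theorem mem_disjointCompl_iff_posPart_negPart {v w : E} :
    w ∈ disjointCompl v ↔ w ∈ disjointCompl v⁺ ∧ w ∈ disjointCompl v⁻ := by
  have hp := posPart_nonneg v
  have hn := negPart_nonneg v
  simp only [mem_disjointCompl]
  rw [abs_of_nonneg hp, abs_of_nonneg hn]
  constructor
  · intro h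
    constructor <;> refine le_antisymm (h ▸ inf_le_inf_right _ ?_) (le_inf ‹_› (abs_nonneg _))
    · exact (posPart_add_negPart v) ▸ le_add_of_nonneg_right hn
    · exact (posPart_add_negPart v) ▸ le_add_of_nonneg_left hp
  · rintro ⟨h1, h2⟩
    rw [← posPart_add_negPart v, inf_comm]
    rw [inf_comm] at h1 h2
    exact inf_add_eq_zero_of_nonneg (abs_nonneg _) hp hn h1 h2

/-- For an order continuous norm, the band generated by a positive element is complemented by
the disjoint complement of that element. -/
theorem exists_add_of_nonneg (hE : HasOrderContinuousNorm E) {a w : E} (ha : 0 ≤ a) (hw : 0 ≤ w) :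
    ∃ x ∈ principalBand a, ∃ y ∈ disjointCompl a, x + y = w := by
  let f : ℕ → E := fun n => w - w ⊓ n • a
  have hf : Antitone f := fun m n hmn =>
    sub_le_sub_left (inf_le_inf_left _ (nsmul_le_nsmul_left ha hmn)) _
  have hdir : DirectedOn (· ≥ ·) (Set.range f) := directedOn_range.2 hf.directed_ge
  obtain ⟨y, hy⟩ := hE (Set.range f) (Set.range_nonempty f) hdir
    ⟨0, by rintro _ ⟨n, rfl⟩; exact sub_nonneg.2 inf_le_left⟩
  have hlim : Tendsto f atTop (𝓝 y) := by
    -- The net runs over the range of `f`; since `f` is antitone, `n ↦ f n` goes to the bottom of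
    -- that range, so the net limit is also the sequential limit.
    let g : ℕ → Set.range f := fun n => ⟨f n, n, rfl⟩
    have hg : Tendsto g atTop atBot := by
      refine tendsto_atBot.2 ?_
      rintro ⟨_, m, rfl⟩
      filter_upwards [eventually_ge_atTop m] with n hn
      exact hf hn
    exact hy.comp hg
  have hlim' : Tendsto (fun n : ℕ => w ⊓ n • a) atTop (𝓝 (w - y)) := by
    simpa [f] using tendsto_const_nhds (x := w) |>.sub hlim
  refine ⟨w - y, ?_, y, ?_, sub_add_cancel w y⟩
  · refine mem_closure_of_tendsto hlim' (Eventually.of_forall fun n => ⟨n, ?_⟩)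
    rw [abs_of_nonneg (le_inf hw (nsmul_nonneg ha n))]
    exact inf_le_right
  · have hy0 : 0 ≤ y := ge_of_tendsto' hlim fun n => sub_nonneg.2 inf_le_left
    -- Increments of the convergent sequence `w ⊓ n • a` tend to `0`, so this bound, uniform in `n`,
    -- forces `a ⊓ y ≤ 0`.
    have hstep : ∀ n, a ⊓ y ≤ w ⊓ (n + 1) • a - w ⊓ n • a := by
      intro n
      rw [le_sub_iff_add_le]
      refine le_inf ?_ ?_
      · calc a ⊓ y + w ⊓ n • a ≤ f n + w ⊓ n • a :=
            add_le_add_left (inf_le_right.trans (hf.le_of_tendsto hlim n)) _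
          _ = w := sub_add_cancel _ _
      · rw [succ_nsmul']
        exact add_le_add inf_le_left inf_le_right
    have h0 : a ⊓ y ≤ 0 := by
      have := ((tendsto_add_atTop_iff_nat 1).2 hlim').sub hlim'
      rw [sub_self] at this
      exact ge_of_tendsto' this hstep
    rw [mem_disjointCompl, abs_of_nonneg ha, abs_of_nonneg hy0]
    exact le_antisymm h0 (le_inf ha hy0)

theorem exists_add_mem_principalBand (hE : HasOrderContinuousNorm E) {a : E} (ha : 0 ≤ a) (w : E) :
    ∃ x ∈ principalBand a, ∃ y ∈ disjointCompl a, x + y = w := by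
  obtain ⟨x, hx, y, hy, hxy⟩ := exists_add_of_nonneg hE ha (posPart_nonneg w)
  obtain ⟨x', hx', y', hy', hxy'⟩ := exists_add_of_nonneg hE ha (negPart_nonneg w)
  refine ⟨x - x', sub_mem hx hx', y - y', sub_mem hy hy', ?_⟩
  rw [← posPart_sub_negPart w, ← hxy, ← hxy']
  abel

theorem principalBand_negPart_le (v : E) : principalBand v⁻ ≤ disjointCompl v⁺ :=
  principalBand_le_disjointCompl (negPart_nonneg v)
    (mem_disjointCompl_comm.1 (posPart_mem_disjointCompl_negPart v))

theorem exists_sign_decomposition (hE : HasOrderContinuousNorm E) (v w : E) :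
    ∃ x ∈ principalBand v⁺, ∃ y ∈ principalBand v⁻, ∃ z ∈ disjointCompl v, w = x + y + z := by
  obtain ⟨x, hx, w₁, hw₁, rfl⟩ := exists_add_mem_principalBand hE (posPart_nonneg v) w
  obtain ⟨y, hy, z, hz, rfl⟩ := exists_add_mem_principalBand hE (negPart_nonneg v) w₁
  refine ⟨x, hx, y, hy, z, mem_disjointCompl_iff_posPart_negPart.2 ⟨?_, hz⟩, by abel⟩
  -- `z` is the remainder minus `y`, and both of these are disjoint from `v⁺`.
  simpa using sub_mem hw₁ (principalBand_negPart_le v hy)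

theorem mem_disjointCompl_of_mem_bands {v x y : E} (hx : x ∈ principalBand v⁺)
    (hy : y ∈ principalBand v⁻) : y ∈ disjointCompl x :=
  mem_disjointCompl_comm.1 <| principalBand_le_disjointCompl (posPart_nonneg v)
    (mem_disjointCompl_comm.1 (principalBand_negPart_le v hy)) hx

theorem mem_disjointCompl_of_mem_posBand {v x z : E} (hx : x ∈ principalBand v⁺)
    (hz : z ∈ disjointCompl v) : z ∈ disjointCompl x :=
  mem_disjointCompl_comm.1 <| principalBand_le_disjointCompl (posPart_nonneg v)
    (mem_disjointCompl_comm.1 (mem_disjointCompl_iff_posPart_negPart.1 hz).1) hx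

theorem mem_disjointCompl_of_mem_negBand {v y z : E} (hy : y ∈ principalBand v⁻)
    (hz : z ∈ disjointCompl v) : z ∈ disjointCompl y :=
  mem_disjointCompl_comm.1 <| principalBand_le_disjointCompl (negPart_nonneg v)
    (mem_disjointCompl_comm.1 (mem_disjointCompl_iff_posPart_negPart.1 hz).2) hy

theorem mem_disjointCompl_of_mem_signSummands {v : E} {i j : Fin 3} (hij : i ≠ j) {x y : E}
    (hx : x ∈ signSummands v i) (hy : y ∈ signSummands v j) : y ∈ disjointCompl x := by
  have key : ∀ {i j : Fin 3}, i < j → ∀ {x y : E}, x ∈ signSummands v i → y ∈ signSummands v j →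
      y ∈ disjointCompl x := by
    intro i j hij x y hx hy
    fin_cases i <;> fin_cases j <;> try exact absurd hij (by decide)
    · exact mem_disjointCompl_of_mem_bands hx hy
    · exact mem_disjointCompl_of_mem_posBand hx hy
    · exact mem_disjointCompl_of_mem_negBand hx hy
  rcases hij.lt_or_gt with h | h
  · exact key h hx hy
  · exact mem_disjointCompl_comm.1 (key h hy hx)

theorem isInternal_signSummands (hE : HasOrderContinuousNorm E) (v : E) :
    DirectSum.IsInternal (signSummands v) := by
  rw [DirectSum.isInternal_submodule_iff_iSupIndep_and_iSup_eq_top]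
  constructor
  · intro i
    rw [Submodule.disjoint_def]
    intro x hx hx'
    refine eq_zero_of_mem_disjointCompl_self ((iSup₂_le fun j hj => ?_ :
      ⨆ j, ⨆ (_ : j ≠ i), signSummands v j ≤ disjointCompl x) hx')
    exact fun y hy => mem_disjointCompl_of_mem_signSummands hj.symm hx hy
  · rw [eq_top_iff]
    intro w _
    obtain ⟨x, hx, y, hy, z, hz, rfl⟩ := exists_sign_decomposition hE v w
    exact add_mem (add_mem (Submodule.mem_iSup_of_mem 0 hx) (Submodule.mem_iSup_of_mem 1 hy))
      (Submodule.mem_iSup_of_mem 2 hz)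

theorem isCompl_posBand (hE : HasOrderContinuousNorm E) (v : E) :
    IsCompl (principalBand v⁺) (principalBand v⁻ ⊔ disjointCompl v) := by
  constructor
  · rw [Submodule.disjoint_def]
    intro x hx hx'
    refine eq_zero_of_mem_disjointCompl_self ((sup_le ?_ ?_ : _ ≤ disjointCompl x) hx')
    · exact fun y hy => mem_disjointCompl_of_mem_bands hx hy
    · exact fun y hy => mem_disjointCompl_of_mem_posBand hx hy
  · rw [codisjoint_iff, eq_top_iff]
    intro w _
    obtain ⟨x, hx, y, hy, z, hz, rfl⟩ := exists_sign_decomposition hE v w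
    rw [add_assoc]
    exact Submodule.add_mem_sup hx (Submodule.add_mem_sup hy hz)

theorem isCompl_negBand (hE : HasOrderContinuousNorm E) (v : E) :
    IsCompl (principalBand v⁻) (principalBand v⁺ ⊔ disjointCompl v) := by
  constructor
  · rw [Submodule.disjoint_def]
    intro y hy hy'
    refine eq_zero_of_mem_disjointCompl_self ((sup_le ?_ ?_ : _ ≤ disjointCompl y) hy')
    · exact fun x hx => mem_disjointCompl_comm.1 (mem_disjointCompl_of_mem_bands hx hy)
    · exact fun z hz => mem_disjointCompl_of_mem_negBand hy hz
  · rw [codisjoint_iff, eq_top_iff]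
    intro w _
    obtain ⟨x, hx, y, hy, z, hz, rfl⟩ := exists_sign_decomposition hE v w
    rw [add_comm x y, add_assoc]
    exact Submodule.add_mem_sup hy (Submodule.add_mem_sup hx hz)

theorem projPos_apply (hE : HasOrderContinuousNorm E) {v x y z : E} (hx : x ∈ principalBand v⁺)
    (hy : y ∈ principalBand v⁻) (hz : z ∈ disjointCompl v) : projPos v (x + y + z) = x := by
  rw [projPos, dif_pos (isCompl_posBand hE v), add_assoc, map_add,
    Submodule.projection_apply_of_mem_left _ hx,
    (Submodule.projection_apply_eq_zero_iff _).2 (Submodule.add_mem_sup hy hz), add_zero]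

theorem projNeg_apply (hE : HasOrderContinuousNorm E) {v x y z : E} (hx : x ∈ principalBand v⁺)
    (hy : y ∈ principalBand v⁻) (hz : z ∈ disjointCompl v) : projNeg v (x + y + z) = y := by
  rw [projNeg, dif_pos (isCompl_negBand hE v), add_comm x y, add_assoc, map_add,
    Submodule.projection_apply_of_mem_left _ hy,
    (Submodule.projection_apply_eq_zero_iff _).2 (Submodule.add_mem_sup hx hz), add_zero]

/-- The projection onto `|v|ᵈ` along the two bands. -/
noncomputable def projDisjoint (v : E) : E →ₗ[ℝ] E :=
  LinearMap.id - projPos v - projNeg v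

theorem projDisjoint_apply (hE : HasOrderContinuousNorm E) {v x y z : E}
    (hx : x ∈ principalBand v⁺) (hy : y ∈ principalBand v⁻) (hz : z ∈ disjointCompl v) :
    projDisjoint v (x + y + z) = z := by
  simp only [projDisjoint, LinearMap.sub_apply, LinearMap.id_apply, projPos_apply hE hx hy hz,
    projNeg_apply hE hx hy hz]
  abel

/-! ### One-sided directional derivatives of the modulus. -/

theorem norm_inv_smul_abs_sub_abs_le (v w : E) (t : ℝ) : ‖t⁻¹ • (|v + t • w| - |v|)‖ ≤ ‖w‖ := by
  rcases eq_or_ne t 0 with rfl | ht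
  · simp
  · rw [norm_smul, norm_inv, inv_mul_le_iff₀ (norm_pos_iff.2 ht), ← norm_smul]
    simpa using norm_abs_sub_abs (v + t • w) v

/-- If `x` lies in the ideal of `a`, then `a + t x ≥ 0` for small `|t|` and the quotient equals `x`
exactly. The quotient is nonexpansive in `x`, so the limit persists on the norm closure. -/
theorem tendsto_abs_quotient_of_mem_principalBand {a x : E} (ha : 0 ≤ a)
    (hx : x ∈ principalBand a) :
    Tendsto (fun t : ℝ => t⁻¹ • (|a + t • x| - a)) (𝓝[≠] 0) (𝓝 x) := by
  rw [Metric.tendsto_nhds]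
  intro ε hε
  obtain ⟨x', ⟨n, hn⟩, hxx'⟩ := Metric.mem_closure_iff.1 hx (ε / 2) (half_pos hε)
  have hsmall : ∀ᶠ t : ℝ in 𝓝[≠] 0, |t| * n ≤ 1 := by
    refine nhdsWithin_le_nhds ?_
    have : Tendsto (fun t : ℝ => |t| * n) (𝓝 0) (𝓝 (|0| * n)) :=
      (continuous_abs.mul continuous_const).tendsto 0
    rw [abs_zero, zero_mul] at this
    exact this.eventually_le_const one_pos
  filter_upwards [hsmall, self_mem_nhdsWithin] with t ht ht0
  have ht0 : t ≠ 0 := ht0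
  have h1 : 0 ≤ a + t • x' := by
    have : -(t • x') ≤ a := calc
      -(t • x') ≤ |t • x'| := neg_le_abs _
      _ ≤ |t| • |x'| := abs_real_smul_le _ _
      _ ≤ |t| • n • a := smul_le_smul_of_nonneg_left hn (abs_nonneg t)
      _ = (|t| * n) • a := by rw [← Nat.cast_smul_eq_nsmul ℝ, smul_smul]
      _ ≤ (1 : ℝ) • a := smul_le_smul_of_nonneg_right ht ha
      _ = a := one_smul _ _
    exact neg_le_iff_add_nonneg.1 this
  have h2 : t⁻¹ • (|a + t • x| - a) - x' = t⁻¹ • (|a + t • x| - |a + t • x'|) := by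
    rw [abs_of_nonneg h1, sub_add_eq_sub_sub, smul_sub _ (|a + t • x| - a), inv_smul_smul₀ ht0]
  have h3 : ‖t⁻¹ • (|a + t • x| - a) - x'‖ ≤ ‖x - x'‖ := by
    rw [h2, norm_smul, norm_inv, inv_mul_le_iff₀ (norm_pos_iff.2 ht0), ← norm_smul]
    refine (norm_abs_sub_abs _ _).trans_eq ?_
    rw [add_sub_add_left_eq_sub, smul_sub]
  calc dist (t⁻¹ • (|a + t • x| - a)) x
      ≤ dist (t⁻¹ • (|a + t • x| - a)) x' + dist x' x := dist_triangle _ _ _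
    _ ≤ dist x x' + dist x' x := add_le_add_left (by rwa [dist_eq_norm, dist_eq_norm]) _
    _ < ε := by rw [dist_comm x' x]; linarith

theorem abs_add_smul_of_decomposition {v x y z : E} (hx : x ∈ principalBand v⁺)
    (hy : y ∈ principalBand v⁻) (hz : z ∈ disjointCompl v) (t : ℝ) :
    |v + t • (x + y + z)| = |v⁺ + t • x| + |v⁻ + t • (-y)| + |t| • |z| := by
  have hp : v⁺ ∈ principalBand v⁺ := Submodule.le_topologicalClosure _
    ⟨1, by rw [abs_of_nonneg (posPart_nonneg v), one_smul]⟩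
  have hn : v⁻ ∈ principalBand v⁻ := Submodule.le_topologicalClosure _
    ⟨1, by rw [abs_of_nonneg (negPart_nonneg v), one_smul]⟩
  have h1 : v⁺ + t • x ∈ principalBand v⁺ := add_mem hp (Submodule.smul_mem _ _ hx)
  have h2 : v⁻ + t • (-y) ∈ principalBand v⁻ := add_mem hn (Submodule.smul_mem _ _ (neg_mem hy))
  have h3 : t • z ∈ disjointCompl v := Submodule.smul_mem _ _ hz
  have h4 : v + t • (x + y + z) = (v⁺ + t • x) + (-(v⁻ + t • (-y)) + t • z) := by
    nth_rewrite 1 [← posPart_sub_negPart v]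
    simp only [smul_add, smul_neg]
    abel
  have h5 : -(v⁻ + t • (-y)) + t • z ∈ disjointCompl (v⁺ + t • x) :=
    add_mem (mem_disjointCompl_of_mem_bands h1 (neg_mem h2))
      (mem_disjointCompl_of_mem_posBand h1 h3)
  have h6 : t • z ∈ disjointCompl (-(v⁻ + t • (-y))) :=
    mem_disjointCompl_of_mem_negBand (neg_mem h2) h3
  rw [h4, abs_add_of_abs_inf_abs_eq_zero h5, abs_add_of_abs_inf_abs_eq_zero h6, abs_neg,
    abs_smul_of_real, add_assoc]

theorem inv_smul_abs_sub_abs_eq {v x y z : E} (hx : x ∈ principalBand v⁺)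
    (hy : y ∈ principalBand v⁻) (hz : z ∈ disjointCompl v) (t : ℝ) :
    t⁻¹ • (|v + t • (x + y + z)| - |v|) = t⁻¹ • (|v⁺ + t • x| - v⁺) +
      t⁻¹ • (|v⁻ + t • (-y)| - v⁻) + (t⁻¹ * |t|) • |z| := by
  rw [abs_add_smul_of_decomposition hx hy hz, ← posPart_add_negPart v, mul_smul, ← smul_add,
    ← smul_add]
  congr 1
  abel

/-- Only the disjoint component depends on the side: `c` is the sign of `t` along `l`. -/
theorem tendsto_abs_quotient_aux (hE : HasOrderContinuousNorm E) (v w : E) {l : Filter ℝ} {c : ℝ}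
    (hl : l ≤ 𝓝[≠] 0) (hc : ∀ᶠ t in l, t⁻¹ * |t| = c) :
    Tendsto (fun t : ℝ => t⁻¹ • (|v + t • w| - |v|)) l
      (𝓝 (latticeSign v w + c • |projDisjoint v w|)) := by
  obtain ⟨x, hx, y, hy, z, hz, rfl⟩ := exists_sign_decomposition hE v w
  rw [latticeSign, LinearMap.sub_apply, projPos_apply hE hx hy hz, projNeg_apply hE hx hy hz,
    projDisjoint_apply hE hx hy hz, sub_eq_add_neg]
  have h := (((tendsto_abs_quotient_of_mem_principalBand (posPart_nonneg v) hx).mono_left hl).add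
    ((tendsto_abs_quotient_of_mem_principalBand (negPart_nonneg v) (neg_mem hy)).mono_left hl)).add
    (tendsto_const_nhds (x := c • |z|))
  refine h.congr' ?_
  filter_upwards [hc] with t ht
  rw [inv_smul_abs_sub_abs_eq hx hy hz, ht]

/-- The right directional derivative of the modulus. -/
theorem tendsto_abs_quotient_right (hE : HasOrderContinuousNorm E) (v w : E) :
    Tendsto (fun t : ℝ => t⁻¹ • (|v + t • w| - |v|)) (𝓝[>] 0)
      (𝓝 (latticeSign v w + |projDisjoint v w|)) := by
  have := tendsto_abs_quotient_aux hE v w (l := 𝓝[>] 0) (c := 1)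
    (nhdsWithin_mono _ fun t ht => ne_of_gt ht) (by
      filter_upwards [self_mem_nhdsWithin] with t ht
      rw [abs_of_pos ht, inv_mul_cancel₀ (ne_of_gt ht)])
  rwa [one_smul] at this

/-- The left directional derivative of the modulus. -/
theorem tendsto_abs_quotient_left (hE : HasOrderContinuousNorm E) (v w : E) :
    Tendsto (fun t : ℝ => t⁻¹ • (|v + t • w| - |v|)) (𝓝[<] 0)
      (𝓝 (latticeSign v w - |projDisjoint v w|)) := by
  have := tendsto_abs_quotient_aux hE v w (l := 𝓝[<] 0) (c := -1)
    (nhdsWithin_mono _ fun t ht => ne_of_lt ht) (by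
      filter_upwards [self_mem_nhdsWithin] with t ht
      rw [abs_of_neg ht, mul_neg, inv_mul_cancel₀ (ne_of_lt ht)])
  rwa [neg_smul, one_smul, ← sub_eq_add_neg] at this

/-- Without a disjoint component, `w` is the sum of its two band components and the sign is their
difference. -/
theorem projPos_eq_of_projDisjoint_eq_zero {v w : E} (h : projDisjoint v w = 0) :
    projPos v w = (2⁻¹ : ℝ) • (latticeSign v w + w) := by
  have h' : w = projPos v w + projNeg v w := by
    rw [projDisjoint, LinearMap.sub_apply, LinearMap.sub_apply, LinearMap.id_apply, sub_sub] at h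
    exact sub_eq_zero.1 h
  nth_rewrite 3 [h']
  rw [latticeSign, LinearMap.sub_apply, sub_add_add_cancel, ← two_smul ℝ,
    inv_smul_smul₀ two_ne_zero]

theorem mem_disjointCompl_of_projDisjoint_eq_zero (hE : HasOrderContinuousNorm E) {u v w : E}
    (h : projDisjoint u v = 0) (hw : w ∈ disjointCompl u) : w ∈ disjointCompl v := by
  obtain ⟨x, hx, y, hy, z, hz, rfl⟩ := exists_sign_decomposition hE u v
  rw [projDisjoint_apply hE hx hy hz] at h
  subst h
  rw [add_zero, mem_disjointCompl_comm]
  exact add_mem (mem_disjointCompl_comm.1 (mem_disjointCompl_of_mem_posBand hx hw))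
    (mem_disjointCompl_comm.1 (mem_disjointCompl_of_mem_negBand hy hw))

end BanachLattice

/-! ### Weak derivatives as `L¹` derivatives along translations, and the chain rule. -/

section TranslationDerivative

set_option linter.unusedSectionVars false

variable {V : Type*} [NormedAddCommGroup V] [NormedSpace ℝ V] [FiniteDimensional ℝ V]
  [MeasurableSpace V] [BorelSpace V] {μ : Measure V} [μ.IsAddHaarMeasure]
  {X : Type*} [NormedAddCommGroup X] [NormedSpace ℝ X]

theorem MeasureTheory.Integrable.continuous_smul_of_hasCompactSupport {f : V → X}
    (hf : Integrable f μ) {φ : V → ℝ} (hφ : Continuous φ) (hφc : HasCompactSupport φ) :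
    Integrable (fun x => φ x • f x) μ :=
  hf.locallyIntegrable.integrable_smul_left_of_hasCompactSupport hφ hφc

theorem integral_smul_translate (f : V → X) (φ : V → ℝ) (a : V) :
    ∫ x, φ x • f (a + x) ∂μ = ∫ x, φ (x - a) • f x ∂μ := by
  rw [← integral_add_left_eq_self (fun x => φ (x - a) • f x) a]
  simp

/-- Translation invariance moves the shift onto the smooth `φ`, so `f` need only be integrable. -/
theorem hasDerivAt_integral_smul_translate {f : V → X} (hf : Integrable f μ) {φ : V → ℝ}
    (hφ : ContDiff ℝ ∞ φ) (hφc : HasCompactSupport φ) (e : V) (s : ℝ) :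
    HasDerivAt (fun s : ℝ => ∫ x, φ x • f (s • e + x) ∂μ)
      (-∫ x, fderiv ℝ φ (x - s • e) e • f x ∂μ) s := by
  have hd : Continuous fun x => fderiv ℝ φ x e :=
    (hφ.continuous_fderiv (by simp)).clm_apply continuous_const
  have hdc : HasCompactSupport fun x => fderiv ℝ φ x e := hφc.fderiv_apply ℝ e
  obtain ⟨C, hC⟩ := hd.bounded_above_of_compact_support hdc
  simp_rw [integral_smul_translate f φ, ← integral_neg, ← neg_smul]
  have hcs : ∀ t : ℝ, HasCompactSupport fun x => φ (x - t • e) := fun t => by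
    simpa [Function.comp_def, sub_eq_add_neg] using
      hφc.comp_homeomorph (Homeomorph.addRight (-(t • e)))
  have hct : ∀ t : ℝ, Continuous fun x => φ (x - t • e) := fun t =>
    hφ.continuous.comp (continuous_id.sub continuous_const)
  refine (hasDerivAt_integral_of_dominated_loc_of_deriv_le (s := Set.univ)
    (bound := fun x => C * ‖f x‖) (F := fun s x => φ (x - s • e) • f x)
    (F' := fun s x => (-fderiv ℝ φ (x - s • e) e) • f x) univ_mem ?_ ?_ ?_ ?_ ?_ ?_).2
  · exact Eventually.of_forall fun t => (hct t).aestronglyMeasurable.smul hf.aestronglyMeasurable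
  · exact hf.continuous_smul_of_hasCompactSupport (hct s) (hcs s)
  · exact (hd.comp (continuous_id.sub continuous_const)).neg.aestronglyMeasurable.smul
      hf.aestronglyMeasurable
  · refine Eventually.of_forall fun x t _ => ?_
    rw [norm_smul, norm_neg]
    exact mul_le_mul_of_nonneg_right (hC _) (norm_nonneg _)
  · exact hf.norm.const_mul C
  · refine Eventually.of_forall fun x t _ => ?_
    have h1 : HasDerivAt (fun t : ℝ => x - t • e) (-e) t := by
      simpa using ((hasDerivAt_id t).smul_const e).const_sub x
    have h2 := ((hφ.differentiable (by simp)) (x - t • e)).hasFDerivAt.comp_hasDerivAt t h1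
    rw [map_neg] at h2
    exact h2.smul_const (f x)

/-- Integration against a continuous function with compact support, as a functional on `L¹`. -/
noncomputable def integralSMulCLM (μ : Measure V) [μ.IsAddHaarMeasure] (X : Type*)
    [NormedAddCommGroup X] [NormedSpace ℝ X] {φ : V → ℝ} (hφ : Continuous φ)
    (hφc : HasCompactSupport φ) : Lp X 1 μ →L[ℝ] X :=
  LinearMap.mkContinuousOfExistsBound
    { toFun := fun f => ∫ x, φ x • f x ∂μ
      map_add' := fun f g => by
        rw [← integral_add ((L1.integrable_coeFn f).continuous_smul_of_hasCompactSupport hφ hφc)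
          ((L1.integrable_coeFn g).continuous_smul_of_hasCompactSupport hφ hφc)]
        refine integral_congr_ae ?_
        filter_upwards [Lp.coeFn_add f g] with x hx
        rw [hx, Pi.add_apply, smul_add]
      map_smul' := fun c f => by
        rw [RingHom.id_apply, ← integral_smul]
        refine integral_congr_ae ?_
        filter_upwards [Lp.coeFn_smul c f] with x hx
        rw [hx, Pi.smul_apply, smul_comm] }
    (by
      obtain ⟨C, hC⟩ := hφ.bounded_above_of_compact_support hφc
      refine ⟨C, fun f => ?_⟩
      rw [L1.norm_eq_integral_norm, ← integral_const_mul]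
      refine norm_integral_le_of_norm_le ((L1.integrable_coeFn f).norm.const_mul C)
        (Eventually.of_forall fun x => ?_)
      rw [norm_smul]
      exact mul_le_mul_of_nonneg_right (hC x) (norm_nonneg _))

theorem integralSMulCLM_apply {φ : V → ℝ} (hφ : Continuous φ) (hφc : HasCompactSupport φ)
    (f : Lp X 1 μ) : integralSMulCLM μ X hφ hφc f = ∫ x, φ x • f x ∂μ := rfl

theorem integralSMulCLM_toL1 {φ : V → ℝ} (hφ : Continuous φ) (hφc : HasCompactSupport φ)
    {f : V → X} (hf : Integrable f μ) :
    integralSMulCLM μ X hφ hφc (hf.toL1 f) = ∫ x, φ x • f x ∂μ := by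
  rw [integralSMulCLM_apply]
  refine integral_congr_ae ?_
  filter_upwards [hf.coeFn_toL1] with x hx
  rw [hx]

theorem lp_one_eq_of_integralSMulCLM_eq [CompleteSpace X] {f g : Lp X 1 μ}
    (h : ∀ (φ : V → ℝ) (hφ : ContDiff ℝ ∞ φ) (hφc : HasCompactSupport φ),
      integralSMulCLM μ X hφ.continuous hφc f = integralSMulCLM μ X hφ.continuous hφc g) :
    f = g :=
  Lp.ext <| ae_eq_of_integral_contDiff_smul_eq (L1.integrable_coeFn f).locallyIntegrable
    (L1.integrable_coeFn g).locallyIntegrable h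

/-- The translates `x ↦ f (s e + x)` of an integrable function, as a curve in `L¹`. -/
noncomputable def translateL1 {f : V → X} (hf : Integrable f μ) (e : V) (s : ℝ) : Lp X 1 μ :=
  (hf.comp_add_left (s • e)).toL1 _

theorem continuous_translateL1 {f : V → X} (hf : Integrable f μ) (e : V) :
    Continuous (translateL1 hf e) := by
  have : Fact ((1 : ℝ≥0∞) ≠ ⊤) := ⟨ENNReal.one_ne_top⟩
  -- The curve is, by definition, an orbit of the translation action on `L¹`, which is continuous
  -- because the exponent is finite.
  have h : Continuous fun s : ℝ => DomAddAct.mk (s • e) +ᵥ hf.toL1 f :=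
    Continuous.vadd (DomAddAct.continuous_mk.comp
      (continuous_id.smul continuous_const : Continuous fun s : ℝ => s • e)) continuous_const
  exact h

theorem translateL1_zero {f : V → X} (hf : Integrable f μ) (e : V) :
    translateL1 hf e 0 = hf.toL1 f := by
  simp [translateL1]

variable [CompleteSpace X]

/-- Test functions separate points of `L¹`. After pairing with one of them, the identity is the
fundamental theorem of calculus, the weak derivative supplying the derivative of the paired curve.
-/
theorem translateL1_sub_eq_integral {U g : V → X} (hU : Integrable U μ) (hg : Integrable g μ)
    {e : V} (h : ∀ φ : V → ℝ, ContDiff ℝ ∞ φ → HasCompactSupport φ →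
      ∫ x, fderiv ℝ φ x e • U x ∂μ = -∫ x, φ x • g x ∂μ) (t : ℝ) :
    translateL1 hU e t - translateL1 hU e 0 = ∫ s in (0 : ℝ)..t, translateL1 hg e s := by
  refine lp_one_eq_of_integralSMulCLM_eq fun φ hφ hφc => ?_
  set Λ := integralSMulCLM μ X hφ.continuous hφc
  have hderiv : ∀ s, HasDerivAt (fun s => Λ (translateL1 hU e s)) (Λ (translateL1 hg e s)) s := by
    intro s
    have h1 := hasDerivAt_integral_smul_translate hU hφ hφc e s
    have h2 : -∫ x, fderiv ℝ φ (x - s • e) e • U x ∂μ = Λ (translateL1 hg e s) := by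
      have h3 := h (fun x => φ (x - s • e)) (hφ.comp (contDiff_id.sub contDiff_const)) (by
        simpa [Function.comp_def, sub_eq_add_neg] using
          hφc.comp_homeomorph (Homeomorph.addRight (-(s • e))))
      simp_rw [fderiv_comp_sub] at h3
      rw [h3, neg_neg, ← integral_smul_translate g φ, translateL1, integralSMulCLM_toL1]
    rw [h2] at h1
    have h4 : (fun s => Λ (translateL1 hU e s)) = fun s => ∫ x, φ x • U (s • e + x) ∂μ := by
      funext s
      rw [translateL1, integralSMulCLM_toL1]
    rwa [h4]
  have hc := continuous_translateL1 hg e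
  rw [← Λ.intervalIntegral_comp_comm (hc.intervalIntegrable _ _), map_sub]
  exact (intervalIntegral.integral_eq_sub_of_hasDerivAt (fun s _ => hderiv s)
    ((Λ.continuous.comp hc).intervalIntegrable _ _)).symm

/-- An integrable function with integrable weak derivative is differentiable in `L¹` along
translations. -/
theorem hasDerivAt_translateL1 {U g : V → X} (hU : Integrable U μ) (hg : Integrable g μ)
    {e : V} (h : ∀ φ : V → ℝ, ContDiff ℝ ∞ φ → HasCompactSupport φ →
      ∫ x, fderiv ℝ φ x e • U x ∂μ = -∫ x, φ x • g x ∂μ) :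
    HasDerivAt (translateL1 hU e) (hg.toL1 g) 0 := by
  have hc := continuous_translateL1 hg e
  have h1 := intervalIntegral.integral_hasDerivAt_right (hc.intervalIntegrable 0 0)
    hc.stronglyMeasurable.stronglyMeasurableAtFilter hc.continuousAt
  rw [translateL1_zero] at h1
  refine (h1.add_const (translateL1 hU e 0)).congr_of_eventuallyEq ?_
  refine Eventually.of_forall fun t => ?_
  exact sub_eq_iff_eq_add.1 (translateL1_sub_eq_integral hU hg h t)

theorem tendsto_integral_norm_translate_quotient {U g : V → X} (hU : Integrable U μ)
    (hg : Integrable g μ)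
    {e : V} (h : ∀ φ : V → ℝ, ContDiff ℝ ∞ φ → HasCompactSupport φ →
      ∫ x, fderiv ℝ φ x e • U x ∂μ = -∫ x, φ x • g x ∂μ) :
    Tendsto (fun t : ℝ => ∫ x, ‖t⁻¹ • (U (t • e + x) - U x) - g x‖ ∂μ) (𝓝[≠] 0) (𝓝 0) := by
  have h1 := (hasDerivAt_iff_tendsto_slope_zero.1 (hasDerivAt_translateL1 hU hg h)).sub_const
    (hg.toL1 g) |>.norm
  rw [sub_self, norm_zero] at h1
  refine h1.congr fun t => ?_
  rw [zero_add, translateL1_zero, translateL1, ← Integrable.toL1_sub, ← Integrable.toL1_smul,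
    ← Integrable.toL1_sub]
  have hq : Integrable (fun x => t⁻¹ • (U (t • e + x) - U x) - g x) μ :=
    (((hU.comp_add_left (t • e)).sub hU).smul t⁻¹).sub hg
  change ‖hq.toL1 _‖ = _
  rw [L1.norm_eq_integral_norm]
  refine integral_congr_ae ?_
  filter_upwards [hq.coeFn_toL1] with x hx
  rw [hx]

/-- Chain rule for a nonexpansive map that has one-sided directional derivatives. -/
theorem integral_fderiv_smul_comp_of_lipschitz {U g : V → X} (hU : Integrable U μ)
    (hg : Integrable g μ)
    {e : V} (h : ∀ φ : V → ℝ, ContDiff ℝ ∞ φ → HasCompactSupport φ →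
      ∫ x, fderiv ℝ φ x e • U x ∂μ = -∫ x, φ x • g x ∂μ)
    {F : X → X} (hF : LipschitzWith 1 F) (hF0 : F 0 = 0) {l : Filter ℝ} [l.NeBot]
    [l.IsCountablyGenerated] (hl : l ≤ 𝓝[≠] 0) {R : V → X} {φ : V → ℝ} (hφ : ContDiff ℝ ∞ φ)
    (hφc : HasCompactSupport φ)
    (hR : ∀ᵐ x ∂μ, φ x ≠ 0 →
      Tendsto (fun t : ℝ => t⁻¹ • (F (U x + t • g x) - F (U x))) l (𝓝 (R x))) :
    ∫ x, fderiv ℝ φ x e • F (U x) ∂μ = -∫ x, φ x • R x ∂μ := by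
  have hFn : ∀ a b, ‖F a - F b‖ ≤ ‖a - b‖ := fun a b => by
    simpa [dist_eq_norm] using hF.dist_le_mul a b
  have hFm : ∀ {f : V → X}, Integrable f μ → Integrable (fun x => F (f x)) μ := fun {f} hf =>
    hf.mono (hF.continuous.comp_aestronglyMeasurable hf.aestronglyMeasurable)
      (Eventually.of_forall fun x => by simpa [hF0] using hFn (f x) 0)
  obtain ⟨C, hC⟩ := hφ.continuous.bounded_above_of_compact_support hφc
  have hφi : ∀ {f : V → X}, Integrable f μ → Integrable (fun x => φ x • f x) μ := fun hf =>
    hf.continuous_smul_of_hasCompactSupport hφ.continuous hφc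
  have hτ : ∀ t : ℝ, Integrable (fun x => F (U (t • e + x))) μ := fun t =>
    hFm (hU.comp_add_left (t • e))
  have hlin : ∀ t : ℝ, Integrable (fun x => F (U x + t • g x)) μ := fun t =>
    hFm (hU.add (hg.smul t))
  have h1 : Tendsto (fun t : ℝ => ∫ x, φ x • t⁻¹ • (F (U (t • e + x)) - F (U x)) ∂μ) l
      (𝓝 (-∫ x, fderiv ℝ φ x e • F (U x) ∂μ)) := by
    have := (hasDerivAt_iff_tendsto_slope_zero.1
      (hasDerivAt_integral_smul_translate (hFm hU) hφ hφc e 0)).mono_left hl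
    simp only [zero_smul, sub_zero, zero_add] at this
    refine this.congr fun t => ?_
    rw [← integral_sub (hφi (hτ t)) (hφi (hFm hU)), ← integral_smul]
    refine integral_congr_ae (Eventually.of_forall fun x => ?_)
    simp only
    rw [← smul_sub, smul_comm]
  have h2 : Tendsto (fun t : ℝ => ∫ x, φ x • t⁻¹ • (F (U x + t • g x) - F (U x)) ∂μ) l
      (𝓝 (∫ x, φ x • R x ∂μ)) := by
    refine tendsto_integral_filter_of_dominated_convergence (fun x => C * ‖g x‖) ?_ ?_
      (hg.norm.const_mul C) ?_
    · exact Eventually.of_forall fun t =>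
        (hφi (((hlin t).sub (hFm hU)).smul t⁻¹)).aestronglyMeasurable
    · refine Eventually.of_forall fun t => Eventually.of_forall fun x => ?_
      rw [norm_smul]
      refine mul_le_mul (hC x) ?_ (norm_nonneg _) ((norm_nonneg _).trans (hC x))
      rcases eq_or_ne t 0 with rfl | ht
      · simp
      · rw [norm_smul, norm_inv, inv_mul_le_iff₀ (norm_pos_iff.2 ht), ← norm_smul]
        simpa using hFn (U x + t • g x) (U x)
    · filter_upwards [hR] with x hx
      rcases eq_or_ne (φ x) 0 with h0 | h0
      · simp [h0]
      · exact (hx h0).const_smul (φ x)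
  -- Since `F` is nonexpansive, replacing the translate of `U` by `U + t g` costs at most `C` times
  -- the `L¹` distance from the difference quotient of `U` to `g`.
  have h3 : Tendsto (fun t : ℝ => ∫ x, φ x • t⁻¹ • (F (U (t • e + x)) - F (U x)) ∂μ -
      ∫ x, φ x • t⁻¹ • (F (U x + t • g x) - F (U x)) ∂μ) l (𝓝 0) := by
    have h4 := ((tendsto_integral_norm_translate_quotient hU hg h).mono_left hl).const_mul C
    rw [mul_zero] at h4
    refine squeeze_zero_norm' ?_ h4
    filter_upwards [hl self_mem_nhdsWithin] with t ht
    have ht : t ≠ 0 := ht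
    have hi₁ : Integrable (fun x => φ x • t⁻¹ • (F (U (t • e + x)) - F (U x))) μ :=
      hφi (((hτ t).sub (hFm hU)).smul t⁻¹)
    have hi₂ : Integrable (fun x => φ x • t⁻¹ • (F (U x + t • g x) - F (U x))) μ :=
      hφi (((hlin t).sub (hFm hU)).smul t⁻¹)
    have hi₃ : Integrable (fun x => t⁻¹ • (U (t • e + x) - U x) - g x) μ :=
      (((hU.comp_add_left (t • e)).sub hU).smul t⁻¹).sub hg
    rw [← integral_sub hi₁ hi₂, ← integral_const_mul]
    refine norm_integral_le_of_norm_le (hi₃.norm.const_mul C)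
      (Eventually.of_forall fun x => ?_)
    rw [← smul_sub, ← smul_sub, sub_sub_sub_cancel_right, norm_smul]
    refine mul_le_mul (hC x) ?_ (norm_nonneg _) ((norm_nonneg _).trans (hC x))
    have h5 : t⁻¹ • (U (t • e + x) - U x) - g x
        = t⁻¹ • (U (t • e + x) - (U x + t • g x)) := by
      rw [sub_add_eq_sub_sub, smul_sub _ (U (t • e + x) - U x), inv_smul_smul₀ ht]
    rw [h5, norm_smul, norm_smul]
    exact mul_le_mul_of_nonneg_left (hFn _ _) (norm_nonneg _)
  have h6 := tendsto_nhds_unique h3 (h1.sub h2)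
  rw [← sub_eq_zero.1 h6.symm, neg_neg]

end TranslationDerivative

/-! ### Reduction from `Ω` to the whole space by cutoffs. -/

section Localization

set_option linter.unusedSectionVars false

variable {V : Type*} [NormedAddCommGroup V] [NormedSpace ℝ V] [FiniteDimensional ℝ V]

theorem exists_contDiff_cutoff {K Ω : Set V} (hK : IsCompact K) (hΩ : IsOpen Ω) (hKΩ : K ⊆ Ω) :
    ∃ η : V → ℝ, ContDiff ℝ ∞ η ∧ HasCompactSupport η ∧ tsupport η ⊆ Ω ∧
      ∀ x ∈ K, η x = 1 ∧ fderiv ℝ η x = 0 := by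
  obtain ⟨K', hK', hKK', hK'Ω⟩ := exists_compact_between hK hΩ hKΩ
  obtain ⟨f, h1, h0, -⟩ := exists_contMDiffMap_one_nhds_of_subset_interior
    (n := ⊤) (modelWithCornersSelf ℝ V) hK.isClosed hKK'
  have hsupp : tsupport f ⊆ K' := closure_minimal
    (fun x hx => by_contra fun hx' => hx (h0 x hx')) hK'.isClosed
  refine ⟨f, f.contMDiff.contDiff, hK'.of_isClosed_subset (isClosed_tsupport _) hsupp,
    hsupp.trans hK'Ω, fun x hx => ?_⟩
  have h2 : ∀ᶠ y in 𝓝 x, f y = 1 := h1.filter_mono (nhds_le_nhdsSet hx)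
  refine ⟨h2.self_of_nhds, ?_⟩
  have h3 : (f : V → ℝ) =ᶠ[𝓝 x] fun _ => (1 : ℝ) := h2
  rw [h3.fderiv_eq]
  simp

variable [MeasurableSpace V] [BorelSpace V] {μ : Measure V} [μ.IsAddHaarMeasure]
  {X : Type*} [NormedAddCommGroup X] [NormedSpace ℝ X]

theorem setIntegral_smul_eq_integral {Ω : Set V} {ψ : V → ℝ} (hψ : tsupport ψ ⊆ Ω) (f : V → X) :
    ∫ x in Ω, ψ x • f x ∂μ = ∫ x, ψ x • f x ∂μ :=
  setIntegral_eq_integral_of_forall_compl_eq_zero fun x hx => by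
    rw [image_eq_zero_of_notMem_tsupport fun h => hx (hψ h), zero_smul]

theorem integrable_smul_of_tsupport_subset {Ω : Set V} {f : V → X}
    (hf : LocallyIntegrable f (μ.restrict Ω)) {ψ : V → ℝ} (hψ : Continuous ψ)
    (hψc : HasCompactSupport ψ) (hψΩ : tsupport ψ ⊆ Ω) : Integrable (fun x => ψ x • f x) μ := by
  refine (integrableOn_iff_integrable_of_support_subset (s := Ω) fun x hx => hψΩ ?_).1
    (hf.integrable_smul_left_of_hasCompactSupport hψ hψc)
  exact subset_tsupport ψ fun h => hx (by simp [h])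

/-- Product rule for the weak derivative of a function multiplied by a cutoff. -/
theorem integral_fderiv_smul_cutoff {Ω : Set V} {u v : V → X}
    (hu : LocallyIntegrable u (μ.restrict Ω)) (hv : LocallyIntegrable v (μ.restrict Ω)) {e : V}
    (h : ∀ φ : V → ℝ, ContDiff ℝ ∞ φ → HasCompactSupport φ → tsupport φ ⊆ Ω →
      ∫ x in Ω, fderiv ℝ φ x e • u x ∂μ = -∫ x in Ω, φ x • v x ∂μ)
    {η : V → ℝ} (hη : ContDiff ℝ ∞ η) (hηc : HasCompactSupport η) (hηΩ : tsupport η ⊆ Ω)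
    {ψ : V → ℝ} (hψ : ContDiff ℝ ∞ ψ) (hψc : HasCompactSupport ψ) :
    ∫ x, fderiv ℝ ψ x e • η x • u x ∂μ =
      -∫ x, ψ x • (η x • v x + fderiv ℝ η x e • u x) ∂μ := by
  have hdη : Continuous fun x => fderiv ℝ η x e :=
    (hη.continuous_fderiv (by simp)).clm_apply continuous_const
  have hdψ : Continuous fun x => fderiv ℝ ψ x e :=
    (hψ.continuous_fderiv (by simp)).clm_apply continuous_const
  have i₁ : Integrable (fun x => fderiv ℝ ψ x e • η x • u x) μ :=
    (integrable_smul_of_tsupport_subset hu hη.continuous hηc hηΩ).continuous_smul_of_hasCompactSupport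
      hdψ (hψc.fderiv_apply ℝ e)
  have i₂ : Integrable (fun x => ψ x • fderiv ℝ η x e • u x) μ :=
    (integrable_smul_of_tsupport_subset hu hdη (hηc.fderiv_apply ℝ e)
      ((tsupport_fderiv_apply_subset ℝ e).trans hηΩ)).continuous_smul_of_hasCompactSupport
      hψ.continuous hψc
  have i₃ : Integrable (fun x => ψ x • η x • v x) μ :=
    (integrable_smul_of_tsupport_subset hv hη.continuous hηc hηΩ).continuous_smul_of_hasCompactSupport
      hψ.continuous hψc
  have hsub : tsupport (fun x => ψ x * η x) ⊆ Ω := (tsupport_mul_subset_right).trans hηΩ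
  have key := h (fun x => ψ x * η x) (hψ.mul hη) hηc.mul_left hsub
  rw [setIntegral_smul_eq_integral hsub, setIntegral_smul_eq_integral
    ((tsupport_fderiv_apply_subset ℝ e).trans hsub)] at key
  have h1 : ∀ x, fderiv ℝ (fun x => ψ x * η x) x e • u x =
      fderiv ℝ ψ x e • η x • u x + ψ x • fderiv ℝ η x e • u x := fun x => by
    rw [fderiv_fun_mul (hψ.differentiable (by simp) x) (hη.differentiable (by simp) x)]
    simp only [_root_.add_apply, _root_.smul_apply, smul_eq_mul,
      smul_smul, ← add_smul]
    congr 1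
    ring
  simp_rw [h1, mul_smul] at key
  rw [integral_add i₁ i₂] at key
  simp_rw [smul_add]
  rw [integral_add i₃ i₂, neg_add, ← key]
  abel

variable [CompleteSpace X]

/-- Multiply `u` by a cutoff `η` equal to `1` near the support of `φ`. The product is integrable on
the whole space, and on that support both it and its weak derivative `η v + (∂η) u` reduce to `u`
and `v`. -/
theorem setIntegral_fderiv_smul_comp_of_lipschitz {Ω : Set V} (hΩ : IsOpen Ω) {u v : V → X}
    (hu : LocallyIntegrable u (μ.restrict Ω)) (hv : LocallyIntegrable v (μ.restrict Ω)) {e : V}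
    (h : ∀ φ : V → ℝ, ContDiff ℝ ∞ φ → HasCompactSupport φ → tsupport φ ⊆ Ω →
      ∫ x in Ω, fderiv ℝ φ x e • u x ∂μ = -∫ x in Ω, φ x • v x ∂μ)
    {F : X → X} (hF : LipschitzWith 1 F) (hF0 : F 0 = 0) {l : Filter ℝ} [l.NeBot]
    [l.IsCountablyGenerated] (hl : l ≤ 𝓝[≠] 0) {R : V → X}
    (hR : ∀ x, Tendsto (fun t : ℝ => t⁻¹ • (F (u x + t • v x) - F (u x))) l (𝓝 (R x)))
    {φ : V → ℝ} (hφ : ContDiff ℝ ∞ φ) (hφc : HasCompactSupport φ) (hφΩ : tsupport φ ⊆ Ω) :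
    ∫ x in Ω, fderiv ℝ φ x e • F (u x) ∂μ = -∫ x in Ω, φ x • R x ∂μ := by
  obtain ⟨η, hη, hηc, hηΩ, hη1⟩ := exists_contDiff_cutoff hφc hΩ hφΩ
  have hdη : Continuous fun x => fderiv ℝ η x e :=
    (hη.continuous_fderiv (by simp)).clm_apply continuous_const
  have hU := integrable_smul_of_tsupport_subset hu hη.continuous hηc hηΩ
  have hg : Integrable (fun x => η x • v x + fderiv ℝ η x e • u x) μ :=
    (integrable_smul_of_tsupport_subset hv hη.continuous hηc hηΩ).add
      (integrable_smul_of_tsupport_subset hu hdη (hηc.fderiv_apply ℝ e)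
        ((tsupport_fderiv_apply_subset ℝ e).trans hηΩ))
  rw [setIntegral_smul_eq_integral hφΩ, setIntegral_smul_eq_integral
    ((tsupport_fderiv_apply_subset ℝ e).trans hφΩ)]
  have key := integral_fderiv_smul_comp_of_lipschitz hU hg
    (fun ψ hψ hψc => integral_fderiv_smul_cutoff hu hv h hη hηc hηΩ hψ hψc) hF hF0 hl
    (R := R) hφ hφc (Eventually.of_forall fun x hx => by
      obtain ⟨h1, h2⟩ := hη1 x (subset_tsupport φ hx)
      simpa [h1, h2] using hR x)
  rw [← key]
  refine integral_congr_ae (Eventually.of_forall fun x => ?_)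
  by_cases hx : x ∈ tsupport φ
  · simp only [(hη1 x hx).1, one_smul]
  · have : fderiv ℝ φ x e = 0 := image_eq_zero_of_notMem_tsupport
      (f := fun x => fderiv ℝ φ x e) fun h => hx (tsupport_fderiv_apply_subset ℝ e h)
    simp only [this, zero_smul]

end Localization

/-! ### Integrability of the directional derivatives. -/

section DirectionalLimit

set_option linter.unusedSectionVars false

variable {α : Type*} [MeasurableSpace α] {ν : Measure α} {E : Type*} [NormedAddCommGroup E]
  [NormedSpace ℝ E] [Lattice E] [IsOrderedAddMonoid E] [IsOrderedModule ℝ E] [HasSolidNorm E]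

/-- Measurability is inherited from the difference quotients, so nothing need be known about how the
band projections depend on the point; the bound `‖R‖ ≤ ‖v‖` covers every `p`. -/
theorem memLp_of_tendsto_abs_quotient {p : ℝ≥0∞} {u v R : α → E} (hu : MemLp u p ν)
    (hv : MemLp v p ν) {l : Filter ℝ} [l.NeBot] [l.IsCountablyGenerated]
    (hR : ∀ x, Tendsto (fun t : ℝ => t⁻¹ • (|u x + t • v x| - |u x|)) l (𝓝 (R x))) :
    MemLp R p ν := by
  have hm : AEStronglyMeasurable R ν := by
    refine aestronglyMeasurable_of_tendsto_ae l (fun t => ?_) (Eventually.of_forall hR)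
    have habs : Continuous fun x : E => |x| := continuous_id.sup continuous_neg
    exact ((habs.comp_aestronglyMeasurable
      (hu.aestronglyMeasurable.add (hv.aestronglyMeasurable.const_smul t))).sub
      (habs.comp_aestronglyMeasurable hu.aestronglyMeasurable)).const_smul t⁻¹
  refine hv.of_le hm (Eventually.of_forall fun x => ?_)
  exact le_of_tendsto (hR x).norm
    (Eventually.of_forall fun t => norm_inv_smul_abs_sub_abs_le _ _ _)

end DirectionalLimit

/-! ### Weak derivatives of `|u|` and `u⁺`. -/

section SobolevLattice

set_option linter.unusedSectionVars false

variable {d : ℕ} {Ω : Set (EuclideanSpace ℝ (Fin d))} {p : ℝ≥0∞} {j : Fin d}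

theorem IsDistribDeriv.smul_add {X : Type*} [NormedAddCommGroup X] [NormedSpace ℝ X]
    {u₁ u₂ v₁ v₂ : EuclideanSpace ℝ (Fin d) → X} (hp : 1 ≤ p)
    (hu₁ : MemLp u₁ p (volume.restrict Ω)) (hu₂ : MemLp u₂ p (volume.restrict Ω))
    (h₁ : IsDistribDeriv Ω p j u₁ v₁) (h₂ : IsDistribDeriv Ω p j u₂ v₂) (c : ℝ) :
    IsDistribDeriv Ω p j (fun ξ => c • (u₁ ξ + u₂ ξ)) (fun ξ => c • (v₁ ξ + v₂ ξ)) := by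
  refine ⟨(h₁.1.add h₂.1).const_smul c, fun φ hφ hφc hφΩ => ?_⟩
  have hd : Continuous fun x => fderiv ℝ φ x (EuclideanSpace.single j 1) :=
    (hφ.continuous_fderiv (by simp)).clm_apply continuous_const
  have hdc : HasCompactSupport fun x => fderiv ℝ φ x (EuclideanSpace.single j 1) :=
    hφc.fderiv_apply ℝ _
  simp_rw [smul_comm _ c, integral_smul, _root_.smul_add]
  rw [integral_add ((hu₁.locallyIntegrable hp).integrable_smul_left_of_hasCompactSupport hd hdc)
      ((hu₂.locallyIntegrable hp).integrable_smul_left_of_hasCompactSupport hd hdc),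
    integral_add
      ((h₁.1.locallyIntegrable hp).integrable_smul_left_of_hasCompactSupport hφ.continuous hφc)
      ((h₂.1.locallyIntegrable hp).integrable_smul_left_of_hasCompactSupport hφ.continuous hφc),
    h₁.2 φ hφ hφc hφΩ, h₂.2 φ hφ hφc hφΩ, ← neg_add, smul_neg, _root_.smul_add]

theorem IsDistribDeriv.congr_ae {X : Type*} [NormedAddCommGroup X] [NormedSpace ℝ X]
    {u v v' : EuclideanSpace ℝ (Fin d) → X} (h : IsDistribDeriv Ω p j u v)
    (hv : v =ᵐ[volume.restrict Ω] v') : IsDistribDeriv Ω p j u v' := by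
  refine ⟨h.1.ae_eq hv, fun φ hφ hφc hφΩ => ?_⟩
  rw [h.2 φ hφ hφc hφΩ, neg_inj]
  refine integral_congr_ae ?_
  filter_upwards [hv] with x hx
  rw [hx]

theorem IsDistribDeriv.ae_eq {X : Type*} [NormedAddCommGroup X] [NormedSpace ℝ X]
    [CompleteSpace X] (hΩ : IsOpen Ω) (hp : 1 ≤ p) {u v v' : EuclideanSpace ℝ (Fin d) → X}
    (h : IsDistribDeriv Ω p j u v) (h' : IsDistribDeriv Ω p j u v') :
    v =ᵐ[volume.restrict Ω] v' := by
  have hint := hΩ.ae_eq_zero_of_integral_contDiff_smul_eq_zero (f := fun x => v x - v' x)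
    (locallyIntegrableOn_of_locallyIntegrable_restrict ((h.1.sub h'.1).locallyIntegrable hp))
    (fun φ hφ hφc hφΩ => by
      rw [← setIntegral_smul_eq_integral hφΩ]
      simp_rw [smul_sub]
      rw [integral_sub
        ((h.1.locallyIntegrable hp).integrable_smul_left_of_hasCompactSupport hφ.continuous hφc)
        ((h'.1.locallyIntegrable hp).integrable_smul_left_of_hasCompactSupport hφ.continuous hφc),
        sub_eq_zero, ← neg_inj, ← h.2 φ hφ hφc hφΩ, ← h'.2 φ hφ hφc hφΩ])
  filter_upwards [(ae_restrict_iff' hΩ.measurableSet).2 hint] with x hx using sub_eq_zero.1 hx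

variable {E : Type*} [NormedAddCommGroup E] [NormedSpace ℝ E] [CompleteSpace E]
    [Lattice E] [IsOrderedAddMonoid E] [IsOrderedModule ℝ E] [HasSolidNorm E]
    {u v : EuclideanSpace ℝ (Fin d) → E}

theorem IsDistribDeriv.abs_of_tendsto (hΩ : IsOpen Ω) (hp : 1 ≤ p)
    (hu : MemLp u p (volume.restrict Ω)) (h : IsDistribDeriv Ω p j u v) {l : Filter ℝ} [l.NeBot]
    [l.IsCountablyGenerated] (hl : l ≤ 𝓝[≠] 0) {R : EuclideanSpace ℝ (Fin d) → E}
    (hR : ∀ x, Tendsto (fun t : ℝ => t⁻¹ • (|u x + t • v x| - |u x|)) l (𝓝 (R x))) :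
    IsDistribDeriv Ω p j (fun ξ => |u ξ|) R :=
  ⟨memLp_of_tendsto_abs_quotient hu h.1 hR, fun _ hφ hφc hφΩ =>
    setIntegral_fderiv_smul_comp_of_lipschitz hΩ (hu.locallyIntegrable hp)
      (h.1.locallyIntegrable hp) h.2 (F := fun x : E => |x|)
      (LipschitzWith.mk_one fun a b => by
        rw [dist_eq_norm, dist_eq_norm]; exact norm_abs_sub_abs a b)
      abs_zero hl hR hφ hφc hφΩ⟩

/-- The left and right directional derivatives of the modulus are weak derivatives of `|u|`, so
they agree; this says that the derivative of `u` has no component disjoint from `u`. -/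
theorem IsDistribDeriv.projDisjoint_ae_eq_zero (hE : HasOrderContinuousNorm E) (hΩ : IsOpen Ω)
    (hp : 1 ≤ p) (hu : MemLp u p (volume.restrict Ω)) (h : IsDistribDeriv Ω p j u v) :
    ∀ᵐ ξ ∂volume.restrict Ω, projDisjoint (u ξ) (v ξ) = 0 := by
  have h₁ := h.abs_of_tendsto hΩ hp hu (l := 𝓝[>] 0) (nhdsWithin_mono _ fun t ht => ne_of_gt ht)
    (fun x => tendsto_abs_quotient_right hE (u x) (v x))
  have h₂ := h.abs_of_tendsto hΩ hp hu (l := 𝓝[<] 0) (nhdsWithin_mono _ fun t ht => ne_of_lt ht)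
    (fun x => tendsto_abs_quotient_left hE (u x) (v x))
  filter_upwards [h₁.ae_eq hΩ hp h₂] with x hx
  rw [sub_eq_add_neg] at hx
  have := IsAddTorsionFree.of_isTorsionFree ℝ E
  -- Cancelling the common sign term leaves an element equal to its own negative.
  have h₃ : |projDisjoint (u x) (v x)| = 0 := self_eq_neg.1 (add_left_cancel hx)
  rw [← norm_eq_zero, ← norm_abs_eq_norm, h₃, norm_zero]

theorem IsDistribDeriv.abs (hE : HasOrderContinuousNorm E) (hΩ : IsOpen Ω) (hp : 1 ≤ p)
    (hu : MemLp u p (volume.restrict Ω)) (h : IsDistribDeriv Ω p j u v) :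
    IsDistribDeriv Ω p j (fun ξ => |u ξ|) (fun ξ => latticeSign (u ξ) (v ξ)) := by
  refine (h.abs_of_tendsto hΩ hp hu (l := 𝓝[>] 0) (nhdsWithin_mono _ fun t ht => ne_of_gt ht)
    (fun x => tendsto_abs_quotient_right hE (u x) (v x))).congr_ae ?_
  filter_upwards [h.projDisjoint_ae_eq_zero hE hΩ hp hu] with x hx
  rw [hx, abs_zero, add_zero]

theorem MeasureTheory.MemLp.lattice_abs {α : Type*} [MeasurableSpace α] {ν : Measure α}
    {f : α → E} (hf : MemLp f p ν) : MemLp (fun x => |f x|) p ν :=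
  hf.of_le (continuous_lattice_abs.comp_aestronglyMeasurable hf.aestronglyMeasurable)
    (Eventually.of_forall fun x => (norm_abs_eq_norm (f x)).le)

theorem posPart_eq_half_smul (a : E) : a⁺ = (2⁻¹ : ℝ) • (|a| + a) := by
  rw [abs_add_eq_two_nsmul_posPart, ← Nat.cast_smul_eq_nsmul ℝ, Nat.cast_ofNat,
    inv_smul_smul₀ two_ne_zero]

theorem IsDistribDeriv.posPart (hE : HasOrderContinuousNorm E) (hΩ : IsOpen Ω) (hp : 1 ≤ p)
    (hu : MemLp u p (volume.restrict Ω)) (h : IsDistribDeriv Ω p j u v) :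
    IsDistribDeriv Ω p j (fun ξ => (u ξ)⁺) (fun ξ => projPos (u ξ) (v ξ)) := by
  simp_rw [posPart_eq_half_smul]
  refine (IsDistribDeriv.smul_add hp hu.lattice_abs hu (h.abs hE hΩ hp hu) h 2⁻¹).congr_ae ?_
  filter_upwards [h.projDisjoint_ae_eq_zero hE hΩ hp hu] with x hx
  exact (projPos_eq_of_projDisjoint_eq_zero hx).symm

end SobolevLattice

theorem mainTheorem6 {E : Type*} [NormedAddCommGroup E] [NormedSpace ℝ E] [CompleteSpace E]
    [Lattice E] [IsOrderedAddMonoid E] [IsOrderedModule ℝ E] [HasSolidNorm E]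
    (hE : HasOrderContinuousNorm E)
    {d : ℕ} {Ω : Set (EuclideanSpace ℝ (Fin d))} (hΩ : IsOpen Ω) {p : ℝ≥0∞} (hp : 1 ≤ p) :
    (∀ v : E, DirectSum.IsInternal (signSummands v)) ∧
    ∀ u : EuclideanSpace ℝ (Fin d) → E, MemSobolev Ω p u →
      (MemSobolev Ω p (fun ξ => |u ξ|) ∧
        ∀ j : Fin d, ∀ v, IsDistribDeriv Ω p j u v →
          IsDistribDeriv Ω p j (fun ξ => |u ξ|) (fun ξ => latticeSign (u ξ) (v ξ))) ∧
      (MemSobolev Ω p (fun ξ => (u ξ)⁺) ∧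
        ∀ j : Fin d, ∀ v, IsDistribDeriv Ω p j u v →
          IsDistribDeriv Ω p j (fun ξ => (u ξ)⁺) (fun ξ => projPos (u ξ) (v ξ))) ∧
      ∀ w : E, 0 ≤ w → (∀ᵐ ξ ∂volume.restrict Ω, |u ξ| ⊓ w = 0) →
        ∀ j : Fin d, ∀ v, IsDistribDeriv Ω p j u v →
          ∀ᵐ ξ ∂volume.restrict Ω, |v ξ| ⊓ w = 0 := by
  refine ⟨isInternal_signSummands hE, fun u ⟨hu, hD⟩ => ⟨⟨⟨hu.lattice_abs, fun j => ?_⟩,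
    fun j v hv => hv.abs hE hΩ hp hu⟩, ⟨⟨?_, fun j => ?_⟩,
    fun j v hv => hv.posPart hE hΩ hp hu⟩, fun w hw huw j v hv => ?_⟩⟩
  · obtain ⟨v, hv⟩ := hD j
    exact ⟨_, hv.abs hE hΩ hp hu⟩
  · simp_rw [posPart_eq_half_smul]
    exact (hu.lattice_abs.add hu).const_smul _
  · obtain ⟨v, hv⟩ := hD j
    exact ⟨_, hv.posPart hE hΩ hp hu⟩
  · filter_upwards [huw, hv.projDisjoint_ae_eq_zero hE hΩ hp hu] with ξ h₁ h₂
    have h₃ : w ∈ disjointCompl (u ξ) := by rwa [mem_disjointCompl, abs_of_nonneg hw]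
    -- Here `v ξ` lies in the sum of the bands of `(u ξ)⁺` and `(u ξ)⁻`, and `w` is disjoint from
    -- both.
    have h₄ := mem_disjointCompl_of_projDisjoint_eq_zero hE h₂ h₃
    rwa [mem_disjointCompl, abs_of_nonneg hw] at h₄
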